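/- Let $D,N\ge 0$ be integers, let $\mathbf p_1,\mathbf p_2,\mathbf p_3\in\mathbb R^D$ be fixed, and let $S_0=\prod_{j=1}^D[lb_j,ub_j]$ with $lb_j<ub_j$ for all $j$. For every integer $T\ge 1$ consider a run of the grey wolf optimizer with $T$ iterations and $N$ agents under the stagnation assumption, that is, with the three best positions frozen at $\mathbf p_1,\mathbf p_2,\mathbf p_3$: agent $i$ starts at a (possibly random) position $\mathbf x_i(1)$, the same for all $T$, and for $1\le t<T$ and $1\le j\le D$ $$x_{ij}(t+1)=\frac13\sum_{k=1}^3\Bigl(p_{kj}+A_{kj}\,\bigl|C_{kj}\,p_{kj}-x_{ij}(t)\bigr|\Bigr),$$ where $A_{kj}\sim U[-a,a]$ with $a=2(1-t/T)$ and $C_{kj}\sim U[0,2]$ are drawn afresh for every iteration $t$, agent $i$, leader $k$ and coordinate $j$, all of them mutually independent and independent of the initial positions $(\mathbf x_1(1),\dots,\mathbf x_N(1))$. Assume that $0\in[lb_j,ub_j]$ for every coordinate $j$ with $p_{1j}=p_{2j}=p_{3j}=0$ (in particular, there is no restriction if there is no such coordinate). Let $i$ be an agent with $\mathbf x_i(1)\ne\frac13\sum_{k=1}^3\mathbf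 p_k$ almost surely. Then the probability that agent $i$ has found $S_0$ by iteration $t$ tends to $1$ as $t\to\infty$, uniformly in the total number of iterations $T\ge t$: $$\lim_{t\to\infty}\ \inf_{T\ge t}\ \mathbb P\bigl\{\exists\, s\in\{1,\dots,t\}:\ \mathbf x_i(s)\in S_0\bigr\}=1 .$$ In particular, the probability that agent $i$ finds $S_0$ within the first $\lfloor 0.05T\rfloor$ iterations of a run of $T$ iterations tends to $1$ as $T\to\infty$. -/

import Mathlib

open MeasureTheory ProbabilityTheory Filter Topology

namespace GWO

/-- The control parameter `a = 2 (1 - t / T)` at iteration `t` of a run with `T` iterations. -/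
noncomputable def control (T t : ℕ) : ℝ := 2 * (1 - (t : ℝ) / (T : ℝ))

/-- The centre `(1/3) (p₁ + p₂ + p₃)` of the three leading positions. -/
noncomputable def center {D : ℕ} (p : Fin 3 → Fin D → ℝ) : Fin D → ℝ :=
  fun j => (1 / 3) * ∑ k, p k j

/-- One position update of a search agent at `x`, with leaders `p` and coefficients `A`, `C`:
the mean over `k` of the intermediate vectors `p_{kj} + A_{kj} |C_{kj} p_{kj} - x_j|`. -/
noncomputable def step {D : ℕ} (p A C : Fin 3 → Fin D → ℝ) (x : Fin D → ℝ) : Fin D → ℝ :=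
  fun j => (1 / 3) * ∑ k, (p k j + A k j * |C k j * p k j - x j|)

/-- `X t i` (`1 ≤ t ≤ T`) is the position at iteration `t` of agent `i` of a swarm of `N` agents
in a run of the grey wolf optimizer with `T` iterations under the stagnation assumption: the
leaders `p` do not move, the agents start at the (possibly random) positions `x₁ i`, and the
coefficients `A t i k j`, `C t i k j` used at iteration `t` are fresh independent uniform
variables on `[-a, a]` and `[0, 2]`. -/
structure IsStagnantRun {Ω : Type*} [MeasurableSpace Ω] (P : Measure Ω) {D N : ℕ}
    (T : ℕ) (p : Fin 3 → Fin D → ℝ) (x₁ : Fin N → Ω → Fin D → ℝ)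
    (A C : ℕ → Fin N → Fin 3 → Fin D → Ω → ℝ)
    (X : ℕ → Fin N → Ω → Fin D → ℝ) : Prop where
  measurable_init : ∀ i, Measurable (x₁ i)
  measurable_A : ∀ t i k j, Measurable (A t i k j)
  measurable_C : ∀ t i k j, Measurable (C t i k j)
  uniform_A : ∀ t, 1 ≤ t → t < T → ∀ i k j,
    pdf.IsUniform (A t i k j) (Set.Icc (-control T t) (control T t)) P volume
  uniform_C : ∀ t, 1 ≤ t → t < T → ∀ i k j,
    pdf.IsUniform (C t i k j) (Set.Icc 0 2) P volume
  /-- all the coefficients are mutually independent -/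
  indep_coeff : iIndepFun
    (Sum.elim (fun q : ℕ × Fin N × Fin 3 × Fin D => A q.1 q.2.1 q.2.2.1 q.2.2.2)
      (fun q : ℕ × Fin N × Fin 3 × Fin D => C q.1 q.2.1 q.2.2.1 q.2.2.2)) P
  /-- the initial swarm is independent of the coefficients -/
  indep_init : IndepFun (fun ω i => x₁ i ω)
    (fun ω => ((fun t i k j => A t i k j ω : ℕ → Fin N → Fin 3 → Fin D → ℝ),
      (fun t i k j => C t i k j ω : ℕ → Fin N → Fin 3 → Fin D → ℝ))) P
  init : ∀ i ω, X 1 i ω = x₁ i ω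
  update : ∀ t, 1 ≤ t → t < T → ∀ i ω,
    X (t + 1) i ω = step p (fun k j => A t i k j ω) (fun k j => C t i k j ω) (X t i ω)

/-- The event that the trajectory `x` has found the set `S` by iteration `t`. -/
def foundBy {Ω : Type*} {D : ℕ} (x : ℕ → Ω → Fin D → ℝ) (S : Set (Fin D → ℝ)) (t : ℕ) : Set Ω :=
  {ω | ∃ s, 1 ≤ s ∧ s ≤ t ∧ x s ω ∈ S}

/-- The filter on pairs `(T, t)` for the limit `t → ∞` subject to `t ≤ T`, uniformly in `T`. -/
def iterToInfty : Filter (ℕ × ℕ) := comap Prod.snd atTop ⊓ 𝓟 {q | q.2 ≤ q.1}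

end GWO

/-!
Let `c` be the mean of the three leaders. Writing `y` for one coordinate of the agent, a step
sends `y - c` to a third of a sum of three independent centred terms, each of variance at most
`(4 / 3) (2 |p| + |y|) ^ 2`. Hence `𝔼 (y - c) ^ 2` contracts by the factor `8 / 9` up to an additive
constant, so the agent stays in a fixed ball with probability close to `1` throughout every run.

During the first quarter of a run `a ≥ 3 / 2`, so all coefficients `|A| ≤ 3 / 2`, `0 ≤ C ≤ 2` are
possible. Some such choice leads any starting point into the box in a number of steps that can be
taken the same for all starting points: in a coordinate with a nonzero leader, a first step leaves a
neighbourhood of `0`, further steps multiply `|y|` by at least `3 / 2`, and once `|y|` is large one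
step reaches the midpoint of the interval; if all the leaders are `0`, a step maps `y` to the mean
of the `A` times `|y|`, and one small step enters the interval, which contains `0`. This is robust
under small changes of the coefficients and of the starting point, so by compactness the agent,
whenever it is in the ball, finds the box within a fixed number of iterations with conditional
probability at least some `δ > 0`. Repeating this `k` times within the first quarter of the run, the
agent fails with probability at most `(1 - δ) ^ k + ε`.
-/

section Independence

variable {Ω : Type*} {m₀ m₁ m₂ mΩ : MeasurableSpace Ω} {P : Measure Ω}

theorem indep_sup_left_of_indep_sup_right [IsZeroOrProbabilityMeasure P]
    (hm₀ : m₀ ≤ mΩ) (hm₁ : m₁ ≤ mΩ) (hm₂ : m₂ ≤ mΩ)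
    (h : Indep m₀ (m₁ ⊔ m₂) P) (h' : Indep m₁ m₂ P) : Indep (m₀ ⊔ m₁) m₂ P := by
  let rects : Set (Set Ω) := Set.image2 (· ∩ ·) {s | MeasurableSet[m₀] s} {t | MeasurableSet[m₁] t}
  have hpi : IsPiSystem rects := by
    rintro _ ⟨s, hs, t, ht, rfl⟩ _ ⟨s', hs', t', ht', rfl⟩ -
    exact ⟨s ∩ s', hs.inter hs', t ∩ t', ht.inter ht', Set.inter_inter_inter_comm ..⟩
  have hgen : m₀ ⊔ m₁ = MeasurableSpace.generateFrom rects := by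
    refine le_antisymm (sup_le (fun s hs => ?_) fun t ht => ?_) ?_
    · exact MeasurableSpace.measurableSet_generateFrom
        ⟨s, hs, Set.univ, MeasurableSet.univ, Set.inter_univ s⟩
    · exact MeasurableSpace.measurableSet_generateFrom
        ⟨Set.univ, MeasurableSet.univ, t, ht, Set.univ_inter t⟩
    · refine MeasurableSpace.generateFrom_le ?_
      rintro _ ⟨s, hs, t, ht, rfl⟩
      exact MeasurableSet.inter (le_sup_left (a := m₀) s hs) (le_sup_right (a := m₀) t ht)
  refine IndepSets.indep (sup_le hm₀ hm₁) hm₂ hpi (@MeasurableSpace.isPiSystem_measurableSet _ m₂)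
    hgen (@MeasurableSpace.generateFrom_measurableSet _ m₂).symm ?_
  rw [IndepSets_iff]
  rintro _ t₂ ⟨s, hs, t, ht, rfl⟩ ht₂
  have ht' := le_sup_left (a := m₁) (b := m₂) t ht
  have ht₂' := le_sup_right (a := m₁) (b := m₂) t₂ ht₂
  rw [Indep_iff] at h h'
  simp only [Set.inter_assoc]
  rw [h s _ hs (ht'.inter ht₂'), h s t hs ht', h' t t₂ ht ht₂, mul_assoc]

theorem measureReal_inter_of_indep (h : Indep m₁ m₂ P) {s t : Set Ω} (hs : MeasurableSet[m₁] s)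
    (ht : MeasurableSet[m₂] t) : P.real (s ∩ t) = P.real s * P.real t := by
  rw [measureReal_def, (Indep_iff _ _ P).1 h s t hs ht, ENNReal.toReal_mul]
  rfl

theorem setLIntegral_comp_of_indep [IsFiniteMeasure P] {α β : Type*} [MeasurableSpace α]
    [MeasurableSpace β] {X : Ω → α} {Y : Ω → β} (hm₁ : m₁ ≤ mΩ) (hX : Measurable[m₁] X)
    (hY : Measurable Y) (h : Indep m₁ (MeasurableSpace.comap Y inferInstance) P) {E : Set Ω}
    (hE : MeasurableSet[m₁] E) {g : α → β → ENNReal} (hg : Measurable g.uncurry) :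
    ∫⁻ ω in E, g (X ω) (Y ω) ∂P = ∫⁻ ω in E, ∫⁻ ω', g (X ω) (Y ω') ∂P ∂P := by
  have hX' : Measurable X := hX.mono hm₁ le_rfl
  have hprod : ((P.restrict E).map fun ω => (X ω, Y ω)) =
      ((P.restrict E).map X).prod (P.map Y) := by
    refine (Measure.prod_eq fun s t hs ht => ?_).symm
    rw [Measure.map_apply (hX'.prodMk hY) (hs.prod ht), Measure.map_apply hX' hs,
      Measure.map_apply hY ht, Measure.restrict_apply ((hX'.prodMk hY) (hs.prod ht)),
      Measure.restrict_apply (hX' hs), ← (Indep_iff _ _ P).1 h _ _ ((hX hs).inter hE) ⟨t, ht, rfl⟩,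
      Set.mk_preimage_prod, Set.inter_right_comm]
  calc ∫⁻ ω in E, g (X ω) (Y ω) ∂P
      = ∫⁻ z, g.uncurry z ∂(P.restrict E).map fun ω => (X ω, Y ω) :=
        (lintegral_map hg (hX'.prodMk hY)).symm
    _ = ∫⁻ x, ∫⁻ y, g x y ∂P.map Y ∂(P.restrict E).map X := by
        rw [hprod, lintegral_prod _ hg.aemeasurable]
        rfl
    _ = ∫⁻ ω in E, ∫⁻ y, g (X ω) y ∂P.map Y ∂P := lintegral_map hg.lintegral_prod_right' hX'
    _ = _ := lintegral_congr fun ω => lintegral_map hg.of_uncurry_left hY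

end Independence

section Uniform

variable {Ω : Type*} [MeasurableSpace Ω] {P : Measure Ω} {X : Ω → ℝ} {u v : ℝ}

theorem volume_inter_Icc_le_of_isUniform (huv : u < v)
    (h : pdf.IsUniform X (Set.Icc u v) P volume) {a b : ℝ} (hab : Set.Icc a b ⊆ Set.Icc u v)
    {W : Set ℝ} (hW : MeasurableSet W) :
    volume.real (W ∩ Set.Icc a b) ≤ (v - u) * P.real (X ⁻¹' W) := by
  have hpos : 0 < v - u := sub_pos.2 huv
  have hle : volume.real (W ∩ Set.Icc a b) ≤ volume.real (Set.Icc u v ∩ W) :=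
    measureReal_mono (by rw [Set.inter_comm]; gcongr)
      (measure_ne_top_of_subset Set.inter_subset_left measure_Icc_lt_top.ne)
  rw [measureReal_def P, h.measure_preimage (by simpa using huv) measure_Icc_lt_top.ne hW,
    ENNReal.toReal_div, ← measureReal_def, ← measureReal_def, Real.volume_real_Icc_of_le huv.le,
    mul_div_cancel₀ _ hpos.ne']
  exact hle

theorem volume_ball_inter_Icc_pos (huv : u < v) {x r : ℝ} (hx : x ∈ Set.Icc u v) (hr : 0 < r) :
    0 < volume.real (Metric.ball x r ∩ Set.Icc u v) := by
  have hne : (Metric.ball x r ∩ Set.Ioo u v).Nonempty := by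
    rw [← closure_Ioo huv.ne] at hx
    exact mem_closure_iff.1 hx _ Metric.isOpen_ball (Metric.mem_ball_self hr)
  have hpos : 0 < volume (Metric.ball x r ∩ Set.Ioo u v) :=
    (Metric.isOpen_ball.inter isOpen_Ioo).measure_pos _ hne
  refine ENNReal.toReal_pos (hpos.trans_le (measure_mono ?_)).ne'
    (measure_ne_top_of_subset Set.inter_subset_right measure_Icc_lt_top.ne)
  exact Set.inter_subset_inter_right _ Set.Ioo_subset_Icc_self

theorem ae_mem_Icc_of_isUniform (hX : Measurable X) (h : pdf.IsUniform X (Set.Icc u v) P volume) :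
    ∀ᵐ ω ∂P, X ω ∈ Set.Icc u v := by
  refine ae_of_ae_map hX.aemeasurable ?_
  rw [h]
  exact ae_cond_mem measurableSet_Icc

theorem integral_comp_of_isUniform (huv : u < v) (hX : Measurable X)
    (h : pdf.IsUniform X (Set.Icc u v) P volume) {f : ℝ → ℝ} (hf : Measurable f) :
    ∫ ω, f (X ω) ∂P = (v - u)⁻¹ * ∫ x in u..v, f x := by
  rw [← integral_map hX.aemeasurable hf.aestronglyMeasurable, h, ProbabilityTheory.cond,
    integral_smul_measure, Real.volume_Icc, intervalIntegral.integral_of_le huv.le,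
    integral_Icc_eq_integral_Ioc, ENNReal.toReal_inv, ENNReal.toReal_ofReal (by linarith),
    smul_eq_mul]

end Uniform

section SymmetricUniform

variable {Ω : Type*} [MeasurableSpace Ω] {P : Measure Ω} {X Y : Ω → ℝ} {a b : ℝ}

theorem integral_of_isUniform_symm (ha : 0 < a) (hX : Measurable X)
    (h : pdf.IsUniform X (Set.Icc (-a) a) P volume) : ∫ ω, X ω ∂P = 0 := by
  simpa using integral_comp_of_isUniform (by linarith) hX h measurable_id

theorem integral_sq_of_isUniform_symm (ha : 0 < a) (hX : Measurable X)
    (h : pdf.IsUniform X (Set.Icc (-a) a) P volume) : ∫ ω, X ω ^ 2 ∂P = a ^ 2 / 3 := by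
  rw [integral_comp_of_isUniform (f := (· ^ 2)) (by linarith) hX h (by fun_prop), integral_pow]
  field_simp
  push_cast
  ring

theorem memLp_mul_of_isUniform_symm [IsFiniteMeasure P] (hX : Measurable X) (hY : Measurable Y)
    (h : pdf.IsUniform X (Set.Icc (-a) a) P volume) (hYb : ∀ᵐ ω ∂P, |Y ω| ≤ b) :
    MemLp (fun ω => X ω * Y ω) 2 P := by
  refine MemLp.of_bound (hX.mul hY).aestronglyMeasurable (a * b) ?_
  filter_upwards [ae_mem_Icc_of_isUniform hX h, hYb] with ω hXω hYω
  rw [Real.norm_eq_abs, abs_mul]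
  have hXa := abs_le.2 hXω
  exact mul_le_mul hXa hYω (abs_nonneg _) ((abs_nonneg _).trans hXa)

theorem integral_mul_of_isUniform_symm (ha : 0 < a) (hX : Measurable X) (hY : Measurable Y)
    (h : pdf.IsUniform X (Set.Icc (-a) a) P volume) (hXY : IndepFun X Y P) :
    ∫ ω, X ω * Y ω ∂P = 0 := by
  rw [hXY.integral_fun_mul_eq_mul_integral hX.aestronglyMeasurable hY.aestronglyMeasurable,
    integral_of_isUniform_symm ha hX h, zero_mul]

theorem integral_mul_sq_le_of_isUniform_symm [IsProbabilityMeasure P] (ha : 0 < a)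
    (hX : Measurable X) (hY : Measurable Y) (h : pdf.IsUniform X (Set.Icc (-a) a) P volume)
    (hXY : IndepFun X Y P) (hYb : ∀ᵐ ω ∂P, |Y ω| ≤ b) :
    ∫ ω, (X ω * Y ω) ^ 2 ∂P ≤ a ^ 2 / 3 * b ^ 2 := by
  have hsq : Measurable fun r : ℝ => r ^ 2 := by fun_prop
  have hYsq : ∫ ω, Y ω ^ 2 ∂P ≤ b ^ 2 := by
    calc ∫ ω, Y ω ^ 2 ∂P ≤ ∫ _, b ^ 2 ∂P := by
          refine integral_mono_of_nonneg (ae_of_all _ fun ω => sq_nonneg _) (integrable_const _) ?_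
          filter_upwards [hYb] with ω hω
          exact sq_le_sq.2 (hω.trans (le_abs_self b))
      _ = b ^ 2 := by simp
  calc ∫ ω, (X ω * Y ω) ^ 2 ∂P = (∫ ω, X ω ^ 2 ∂P) * ∫ ω, Y ω ^ 2 ∂P := by
        simp only [mul_pow]
        exact (hXY.comp hsq hsq).integral_fun_mul_eq_mul_integral
          (hsq.comp hX).aestronglyMeasurable (hsq.comp hY).aestronglyMeasurable
    _ ≤ a ^ 2 / 3 * b ^ 2 := by
        rw [integral_sq_of_isUniform_symm ha hX h]
        gcongr

end SymmetricUniform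

theorem integral_sq_sum_eq_sum_integral_sq {Ω ι : Type*} [MeasurableSpace Ω] {P : Measure Ω}
    [IsProbabilityMeasure P] {Y : ι → Ω → ℝ} {s : Finset ι} (hY : ∀ k ∈ s, MemLp (Y k) 2 P)
    (hmean : ∀ k ∈ s, ∫ ω, Y k ω ∂P = 0)
    (hindep : Set.Pairwise ↑s fun k l => IndepFun (Y k) (Y l) P) :
    ∫ ω, (∑ k ∈ s, Y k ω) ^ 2 ∂P = ∑ k ∈ s, ∫ ω, Y k ω ^ 2 ∂P := by
  have hsum : ∫ ω, (∑ k ∈ s, Y k) ω ∂P = 0 := by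
    simp only [Finset.sum_apply]
    rw [integral_finsetSum _ fun k hk => (hY k hk).integrable one_le_two]
    exact Finset.sum_eq_zero hmean
  have hvar := IndepFun.variance_sum hY hindep
  rw [variance_of_integral_eq_zero (memLp_finsetSum' s hY).aemeasurable hsum] at hvar
  simp only [Finset.sum_apply] at hvar
  rw [hvar]
  exact Finset.sum_congr rfl fun k hk =>
    variance_of_integral_eq_zero (hY k hk).aemeasurable (hmean k hk)

theorem exists_measure_preimage_compl_closedBall_le {Ω E : Type*} [MeasurableSpace Ω]
    {P : Measure Ω} [IsFiniteMeasure P] [PseudoMetricSpace E] [CompleteSpace E]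
    [SecondCountableTopology E] [MeasurableSpace E] [BorelSpace E] {Y : Ω → E} (hY : Measurable Y)
    (c : E) {ε : ENNReal} (hε : 0 < ε) : ∃ R, P (Y ⁻¹' (Metric.closedBall c R)ᶜ) ≤ ε := by
  have htight := tendsto_measure_compl_closedBall_of_isTightMeasureSet
    (isTightMeasureSet_singleton (μ := P.map Y)) c
  simp only [iSup_singleton,
    Measure.map_apply hY Metric.isClosed_closedBall.measurableSet.compl] at htight
  exact (htight.eventually_le_const hε).exists

/-- The points from which some control in `K` forces the controlled map `f` into `B`, robustly:
the control and the point may both be perturbed a little. The set `B` need not be open, which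
matters for target boxes that have the fixed point `0` of a coordinate on their boundary. -/
def robustPreimage {U E : Type*} [TopologicalSpace U] [TopologicalSpace E]
    (f : U → E → E) (K : Set U) (B : Set E) : Set E :=
  {x | ∃ u ∈ K, ∀ᶠ q in 𝓝 (u, x), f q.1 q.2 ∈ B}

section RobustPreimage

variable {U E : Type*} [TopologicalSpace U] [TopologicalSpace E] {f : U → E → E} {K : Set U}

theorem robustPreimage_mono {B B' : Set E} (h : B ⊆ B') :
    robustPreimage f K B ⊆ robustPreimage f K B' :=
  fun _ ⟨u, hu, hB⟩ => ⟨u, hu, hB.mono fun _ hq => h hq⟩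

theorem mem_robustPreimage_of_mem_interior (hf : Continuous f.uncurry) {B : Set E} {u : U}
    (hu : u ∈ K) {x : E} (hx : f u x ∈ interior B) : x ∈ robustPreimage f K B :=
  ⟨u, hu, hf.continuousAt.eventually (mem_interior_iff_mem_nhds.1 hx)⟩

theorem robustPreimage_univ (hK : K.Nonempty) : robustPreimage f K Set.univ = Set.univ :=
  Set.eq_univ_of_forall fun _ =>
    ⟨hK.some, hK.some_mem, Eventually.of_forall fun _ => Set.mem_univ _⟩

end RobustPreimage

namespace GWO

/-- One coordinate of a position update, as a map controlled by its coefficients `u = (a, c)`. -/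
noncomputable def coordStep (p : Fin 3 → ℝ) (u : (Fin 3 → ℝ) × (Fin 3 → ℝ)) (x : ℝ) : ℝ :=
  (1 / 3) * ∑ k, (p k + u.1 k * |u.2 k * p k - x|)

/-- Coefficients of one coordinate that are possible throughout the first quarter of a run, when
the control parameter is at least `3 / 2`. -/
def coordRange : Set ((Fin 3 → ℝ) × (Fin 3 → ℝ)) :=
  {u | (∀ k, u.1 k ∈ Set.Icc (-(3 / 2)) (3 / 2)) ∧ ∀ k, u.2 k ∈ Set.Icc 0 2}

section Coordinate

variable {p : Fin 3 → ℝ} {lb ub : ℝ}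

theorem continuous_coordStep (p : Fin 3 → ℝ) : Continuous (coordStep p).uncurry := by
  unfold Function.uncurry coordStep
  fun_prop

theorem exists_half_sum_le_abs_coordStep (p : Fin 3 → ℝ) :
    ∃ a : Fin 3 → ℝ, (∀ k, a k ∈ Set.Icc (-(3 / 2)) (3 / 2)) ∧
      ∀ c x, 1 / 2 * ∑ k, |c k * p k - x| ≤ |coordStep p (a, c) x| := by
  rcases le_total 0 (∑ k, p k) with h | h
  · refine ⟨fun _ => 3 / 2, fun _ => by norm_num, fun c x => le_trans ?_ (le_abs_self _)⟩
    simp only [coordStep, Finset.sum_add_distrib, ← Finset.mul_sum]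
    linarith
  · refine ⟨fun _ => -(3 / 2), fun _ => by norm_num, fun c x => le_trans ?_ (neg_le_abs _)⟩
    simp only [coordStep, Finset.sum_add_distrib, ← Finset.mul_sum]
    linarith

theorem exists_sum_abs_le_sum_abs_sub (p : Fin 3 → ℝ) (x : ℝ) :
    ∃ c : Fin 3 → ℝ, (∀ k, c k ∈ Set.Icc 0 2) ∧ ∑ k, |p k| ≤ ∑ k, |c k * p k - x| := by
  by_contra! h
  have h₀ := h (fun _ => 0) fun _ => by norm_num
  have h₂ := h (fun _ => 2) fun _ => by norm_num
  have key : ∑ k, 2 * |p k| ≤ ∑ k, (|0 * p k - x| + |2 * p k - x|) := by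
    refine Finset.sum_le_sum fun k _ => ?_
    calc 2 * |p k| = |(2 * p k - x) - (0 * p k - x)| := by
          rw [← abs_two, ← abs_mul]; ring_nf
      _ ≤ |2 * p k - x| + |0 * p k - x| := abs_sub _ _
      _ = _ := add_comm _ _
  rw [← Finset.mul_sum, Finset.sum_add_distrib] at key
  linarith

theorem exists_lt_abs_coordStep {ρ : ℝ} (hρ : ρ < 1 / 2 * ∑ k, |p k|) (x : ℝ) :
    ∃ u ∈ coordRange, ρ < |coordStep p u x| := by
  obtain ⟨a, ha, hstep⟩ := exists_half_sum_le_abs_coordStep p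
  obtain ⟨c, hc, hsum⟩ := exists_sum_abs_le_sum_abs_sub p x
  exact ⟨(a, c), ⟨ha, hc⟩, hρ.trans_le ((by linarith : _ ≤ _).trans (hstep c x))⟩

theorem exists_three_halves_mul_abs_le_abs_coordStep (p : Fin 3 → ℝ) (x : ℝ) :
    ∃ u ∈ coordRange, 3 / 2 * |x| ≤ |coordStep p u x| := by
  obtain ⟨a, ha, hstep⟩ := exists_half_sum_le_abs_coordStep p
  refine ⟨(a, 0), ⟨ha, fun _ => by simp⟩, le_trans ?_ (hstep 0 x)⟩
  simp only [Pi.zero_apply, zero_mul, zero_sub, abs_neg, Finset.sum_const, Finset.card_univ,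
    Fintype.card_fin, nsmul_eq_mul, Nat.cast_ofNat]
  linarith

theorem exists_coordStep_eq {x z : ℝ} (h : |z - 1 / 3 * ∑ k, p k| < |x|) :
    ∃ u ∈ coordRange, coordStep p u x = z := by
  set y := z - 1 / 3 * ∑ k, p k with hy
  have hx : 0 < |x| := (abs_nonneg y).trans_lt h
  have hle : |y / (|x|)| ≤ 3 / 2 := by
    rw [abs_div, abs_abs, div_le_iff₀ hx]
    linarith
  refine ⟨(fun _ => y / |x|, 0), ⟨fun _ => abs_le.1 hle, fun _ => by simp⟩, ?_⟩
  simp only [coordStep, Pi.zero_apply, zero_mul, zero_sub, abs_neg, Finset.sum_add_distrib,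
    Finset.sum_const, Finset.card_univ, Fintype.card_fin, nsmul_eq_mul, Nat.cast_ofNat]
  field_simp
  linarith

theorem isOpen_lt_mul_abs (c y : ℝ) : IsOpen {x : ℝ | y < c * |x|} :=
  isOpen_lt continuous_const (by fun_prop)

theorem lt_mul_abs_subset_iterate_robustPreimage (hlu : lb < ub) (l : ℕ) :
    {x | |(lb + ub) / 2 - 1 / 3 * ∑ k, p k| < (3 / 2) ^ l * |x|} ⊆
      (robustPreimage (coordStep p) coordRange)^[l + 1] (Set.Icc lb ub) := by
  induction l with
  | zero =>
    intro x hx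
    obtain ⟨u, hu, hmid⟩ := exists_coordStep_eq (p := p) (x := x) (z := (lb + ub) / 2)
      (by simpa using hx)
    refine mem_robustPreimage_of_mem_interior (continuous_coordStep p) hu ?_
    rw [interior_Icc, hmid]
    exact ⟨by linarith, by linarith⟩
  | succ l ih =>
    intro x hx
    obtain ⟨u, hu, hgrow⟩ := exists_three_halves_mul_abs_le_abs_coordStep p x
    rw [Function.iterate_succ_apply']
    refine robustPreimage_mono ih
      (mem_robustPreimage_of_mem_interior (continuous_coordStep p) hu ?_)
    rw [(isOpen_lt_mul_abs _ _).interior_eq]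
    calc _ < (3 / 2) ^ (l + 1) * |x| := hx
      _ = (3 / 2) ^ l * (3 / 2 * |x|) := by ring
      _ ≤ (3 / 2) ^ l * |coordStep p u x| := by gcongr

theorem eventually_iterate_robustPreimage_eq_univ_of_ne_zero (hlu : lb < ub) {k₀ : Fin 3}
    (hk₀ : p k₀ ≠ 0) :
    ∀ᶠ n in atTop, (robustPreimage (coordStep p) coordRange)^[n] (Set.Icc lb ub) = Set.univ := by
  have hsum : 0 < ∑ k, |p k| :=
    Finset.sum_pos' (fun k _ => abs_nonneg _) ⟨k₀, Finset.mem_univ _, abs_pos.2 hk₀⟩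
  set ρ := 1 / 4 * ∑ k, |p k| with hρ
  have hlarge : ∀ᶠ l : ℕ in atTop, |(lb + ub) / 2 - 1 / 3 * ∑ k, p k| < (3 / 2) ^ l * ρ :=
    ((tendsto_pow_atTop_atTop_of_one_lt (by norm_num)).atTop_mul_const
      (by positivity)).eventually_gt_atTop _
  rw [← map_add_atTop_eq_nat 2, eventually_map]
  filter_upwards [hlarge] with l hl
  refine Set.eq_univ_of_forall fun x => ?_
  obtain ⟨u, hu, hescape⟩ := exists_lt_abs_coordStep (p := p) (ρ := ρ) (by linarith) x
  rw [Function.iterate_succ_apply']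
  refine robustPreimage_mono (lt_mul_abs_subset_iterate_robustPreimage hlu l)
    (mem_robustPreimage_of_mem_interior (continuous_coordStep p) hu ?_)
  rw [(isOpen_lt_mul_abs _ _).interior_eq]
  exact hl.trans (by gcongr)

theorem coordStep_eq_mul_abs (hp : ∀ k, p k = 0) (u : (Fin 3 → ℝ) × (Fin 3 → ℝ)) (x : ℝ) :
    coordStep p u x = (1 / 3 * ∑ k, u.1 k) * |x| := by
  simp only [coordStep, hp, mul_zero, zero_add, zero_sub, abs_neg, ← Finset.sum_mul, mul_assoc]

-- The control sends the outer point `R > |x|` to the midpoint of the interval, so points near `x`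
-- move to the segment between `0` and a point near that midpoint.
theorem robustPreimage_Icc_eq_univ_of_eq_zero (hlu : lb < ub) (hp : ∀ k, p k = 0)
    (h0 : (0 : ℝ) ∈ Set.Icc lb ub) :
    robustPreimage (coordStep p) coordRange (Set.Icc lb ub) = Set.univ := by
  refine Set.eq_univ_of_forall fun x => ?_
  set m := (lb + ub) / 2 with hm
  set R := |x| + |m| + 1 with hR
  have hR0 : 0 < R := by positivity
  have hle : |m / R| ≤ 3 / 2 := by
    rw [abs_div, abs_of_pos hR0, div_le_iff₀ hR0]
    linarith [abs_nonneg x, abs_nonneg m]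
  let u : (Fin 3 → ℝ) × (Fin 3 → ℝ) := (fun _ => m / R, 0)
  refine ⟨u, ⟨fun _ => abs_le.1 hle, fun _ => by simp [u]⟩, ?_⟩
  have hmid : (1 / 3 * ∑ k, u.1 k) * R = m := by
    simp only [u, Finset.sum_const, Finset.card_univ, Fintype.card_fin, nsmul_eq_mul,
      Nat.cast_ofNat]
    field_simp
  have hcont : Continuous fun q : ((Fin 3 → ℝ) × (Fin 3 → ℝ)) × ℝ =>
      (1 / 3 * ∑ k, q.1.1 k) * R := by fun_prop
  have hbig : ∀ᶠ q in 𝓝 (u, x), (1 / 3 * ∑ k, q.1.1 k) * R ∈ Set.Icc lb ub :=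
    (hcont.tendsto' (u, x) m hmid).eventually (Icc_mem_nhds (by linarith) (by linarith))
  have hsmall : ∀ᶠ q in 𝓝 (u, x), |q.2| < R :=
    ContinuousAt.eventually_lt (by fun_prop) continuousAt_const
      (by linarith [hR, abs_nonneg m])
  filter_upwards [hbig, hsmall] with q hq hqR
  have hθ : |q.2| / R ∈ Set.Icc (0 : ℝ) 1 := ⟨by positivity, (div_le_one hR0).2 hqR.le⟩
  have hscale := (convex_Icc lb ub).smul_mem_of_zero_mem h0 hq hθ
  rw [coordStep_eq_mul_abs hp]
  convert hscale using 1
  rw [smul_eq_mul]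
  field_simp

theorem eventually_iterate_robustPreimage_eq_univ (hlu : lb < ub)
    (h0 : (∀ k, p k = 0) → 0 ∈ Set.Icc lb ub) :
    ∀ᶠ n in atTop, (robustPreimage (coordStep p) coordRange)^[n] (Set.Icc lb ub) = Set.univ := by
  by_cases hp : ∀ k, p k = 0
  · rw [← map_add_atTop_eq_nat 1, eventually_map]
    refine Eventually.of_forall fun n => ?_
    rw [Function.iterate_succ_apply, robustPreimage_Icc_eq_univ_of_eq_zero hlu hp (h0 hp)]
    exact Function.iterate_fixed (robustPreimage_univ ⟨0, by norm_num [coordRange]⟩) n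
  · obtain ⟨k₀, hk₀⟩ := not_forall.1 hp
    exact eventually_iterate_robustPreimage_eq_univ_of_ne_zero hlu hk₀

end Coordinate

/-- The coefficients of one position update of an agent, indexed as the arguments of `step`. -/
abbrev Coeff (D : ℕ) : Type := (Fin 3 → Fin D → ℝ) × (Fin 3 → Fin D → ℝ)

/-- Coefficients that are possible throughout the first quarter of a run, as for `coordRange`. -/
def coeffRange (D : ℕ) : Set (Coeff D) :=
  {u | (∀ k j, u.1 k j ∈ Set.Icc (-(3 / 2)) (3 / 2)) ∧ ∀ k j, u.2 k j ∈ Set.Icc 0 2}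

/-- The position update `step`, as a map controlled by its coefficients. -/
noncomputable def move {D : ℕ} (p : Fin 3 → Fin D → ℝ) (u : Coeff D) (x : Fin D → ℝ) : Fin D → ℝ :=
  step p u.1 u.2 x

section Swarm

variable {D : ℕ} {p : Fin 3 → Fin D → ℝ}

theorem continuous_move (p : Fin 3 → Fin D → ℝ) : Continuous (move p).uncurry := by
  unfold Function.uncurry move step
  fun_prop

theorem pi_robustPreimage_subset (B : Fin D → Set ℝ) :
    Set.univ.pi (fun j => robustPreimage (coordStep (p · j)) coordRange (B j)) ⊆
      robustPreimage (move p) (coeffRange D) (Set.univ.pi B) := by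
  intro x hx
  choose u hu hB using fun j => hx j (Set.mem_univ j)
  let v : Coeff D := (fun k j => (u j).1 k, fun k j => (u j).2 k)
  refine ⟨v, ⟨fun k j => (hu j).1 k, fun k j => (hu j).2 k⟩, ?_⟩
  simp only [Set.mem_univ_pi, eventually_all]
  intro j
  have hproj : Continuous fun q : Coeff D × (Fin D → ℝ) =>
      ((fun k => q.1.1 k j, fun k => q.1.2 k j), q.2 j) := by fun_prop
  exact (hproj.tendsto (v, x)).eventually (hB j)

theorem pi_iterate_robustPreimage_subset (B : Fin D → Set ℝ) (n : ℕ) :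
    Set.univ.pi (fun j => (robustPreimage (coordStep (p · j)) coordRange)^[n] (B j)) ⊆
      (robustPreimage (move p) (coeffRange D))^[n] (Set.univ.pi B) := by
  induction n with
  | zero => exact subset_rfl
  | succ n ih =>
    simp only [Function.iterate_succ_apply']
    exact (pi_robustPreimage_subset _).trans (robustPreimage_mono ih)

theorem eventually_iterate_robustPreimage_move_eq_univ {lb ub : Fin D → ℝ}
    (hbox : ∀ j, lb j < ub j) (hdeg : ∀ j, (∀ k, p k j = 0) → 0 ∈ Set.Icc (lb j) (ub j)) :
    ∀ᶠ n in atTop, (robustPreimage (move p) (coeffRange D))^[n] (Set.Icc lb ub) = Set.univ := by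
  have hcoord := eventually_all.2 fun j =>
    eventually_iterate_robustPreimage_eq_univ (hbox j) (hdeg j)
  filter_upwards [hcoord] with n hn
  refine Set.eq_univ_of_univ_subset ?_
  rw [← Set.pi_univ_Icc]
  refine subset_trans ?_ (pi_iterate_robustPreimage_subset _ n)
  simp only [hn, Set.pi_univ, subset_rfl]

end Swarm

theorem control_le_two (T t : ℕ) : control T t ≤ 2 := by
  have : (0 : ℝ) ≤ (t : ℝ) / T := by positivity
  unfold control
  linarith

theorem control_pos {T t : ℕ} (h : t < T) : 0 < control T t := by
  have hT : (0 : ℝ) < T := by exact_mod_cast (Nat.zero_le t).trans_lt h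
  have : (t : ℝ) / T < 1 := by
    rw [div_lt_one hT]
    exact_mod_cast h
  unfold control
  linarith

theorem three_halves_le_control {T t : ℕ} (hT : 0 < T) (h : 4 * t ≤ T) : 3 / 2 ≤ control T t := by
  have : (t : ℝ) / T ≤ 1 / 4 := by
    rw [div_le_div_iff₀ (by exact_mod_cast hT) (by norm_num)]
    exact_mod_cast (by omega : t * 4 ≤ 1 * T)
  unfold control
  linarith

/-- All the coefficients of a run as a single family: the one that is assumed independent. -/
abbrev coeffFamily {Ω : Type*} {D N : ℕ} (A C : ℕ → Fin N → Fin 3 → Fin D → Ω → ℝ) :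
    (ℕ × Fin N × Fin 3 × Fin D) ⊕ (ℕ × Fin N × Fin 3 × Fin D) → Ω → ℝ :=
  Sum.elim (fun q => A q.1 q.2.1 q.2.2.1 q.2.2.2) (fun q => C q.1 q.2.1 q.2.2.1 q.2.2.2)

/-- The iteration in which a member of `coeffFamily` is used. -/
abbrev coeffTime {D N : ℕ} :
    (ℕ × Fin N × Fin 3 × Fin D) ⊕ (ℕ × Fin N × Fin 3 × Fin D) → ℕ :=
  Sum.elim Prod.fst Prod.fst

/-- The coefficients that agent `i` uses in iteration `t`. -/
def coeffAt {Ω : Type*} {D N : ℕ} (A C : ℕ → Fin N → Fin 3 → Fin D → Ω → ℝ) (i : Fin N) (t : ℕ)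
    (ω : Ω) : Coeff D :=
  (fun k j => A t i k j ω, fun k j => C t i k j ω)

/-- The information available when iteration `t` begins: the initial swarm and the coefficients
of the earlier iterations. -/
abbrev past {Ω : Type*} {D N : ℕ} (x₁ : Fin N → Ω → Fin D → ℝ)
    (A C : ℕ → Fin N → Fin 3 → Fin D → Ω → ℝ) (t : ℕ) : MeasurableSpace Ω :=
  MeasurableSpace.comap (fun ω i => x₁ i ω) inferInstance ⊔
    ⨆ q ∈ {q | coeffTime q < t}, MeasurableSpace.comap (coeffFamily A C q) inferInstance

section Coefficients

variable {Ω : Type*} {m : MeasurableSpace Ω} {D N : ℕ} {x₁ : Fin N → Ω → Fin D → ℝ}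
  {A C : ℕ → Fin N → Fin 3 → Fin D → Ω → ℝ} {i : Fin N} {s t : ℕ}

theorem measurable_coeffAt_of_coeffFamily
    (h : ∀ q, coeffTime q = t → Measurable (coeffFamily A C q)) : Measurable (coeffAt A C i t) :=
  Measurable.prodMk
    (measurable_pi_lambda _ fun k => measurable_pi_lambda _ fun j => h (.inl (t, i, k, j)) rfl)
    (measurable_pi_lambda _ fun k => measurable_pi_lambda _ fun j => h (.inr (t, i, k, j)) rfl)

theorem comap_coeffAt_le :
    MeasurableSpace.comap (coeffAt A C i t) inferInstance ≤
      ⨆ q ∈ {q | coeffTime q = t}, MeasurableSpace.comap (coeffFamily A C q) inferInstance :=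
  (measurable_coeffAt_of_coeffFamily fun _ hq => (comap_measurable _).mono
    (le_biSup (fun q => MeasurableSpace.comap (coeffFamily A C q) inferInstance) hq)
    le_rfl).comap_le

theorem past_mono (hst : s ≤ t) : past x₁ A C s ≤ past x₁ A C t :=
  sup_le_sup le_rfl (biSup_mono fun _ hq => lt_of_lt_of_le hq hst)

theorem measurable_coeffAt_past (hst : s < t) : Measurable[past x₁ A C t] (coeffAt A C i s) :=
  (comap_measurable _).mono (comap_coeffAt_le.trans
    (le_sup_of_le_right (biSup_mono fun _ hq => lt_of_eq_of_lt hq hst))) le_rfl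

end Coefficients

section Run

variable {Ω : Type*} [MeasurableSpace Ω] {P : Measure Ω} {D N T : ℕ}
  {p : Fin 3 → Fin D → ℝ} {x₁ : Fin N → Ω → Fin D → ℝ}
  {A C : ℕ → Fin N → Fin 3 → Fin D → Ω → ℝ} {X : ℕ → Fin N → Ω → Fin D → ℝ}
  {i : Fin N} {t : ℕ}

namespace IsStagnantRun

theorem measurable_coeffFamily (h : IsStagnantRun P T p x₁ A C X) :
    ∀ q, Measurable (coeffFamily A C q) := by
  rintro (q | q)
  exacts [h.measurable_A .., h.measurable_C ..]

theorem measurable_coeffAt (h : IsStagnantRun P T p x₁ A C X) (i : Fin N) (t : ℕ) :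
    Measurable (coeffAt A C i t) :=
  measurable_coeffAt_of_coeffFamily fun q _ => h.measurable_coeffFamily q

theorem past_le (h : IsStagnantRun P T p x₁ A C X) (t : ℕ) :
    past x₁ A C t ≤ (inferInstance : MeasurableSpace Ω) :=
  sup_le (measurable_pi_lambda _ h.measurable_init).comap_le
    (iSup₂_le fun q _ => (h.measurable_coeffFamily q).comap_le)

theorem move_coeffAt (h : IsStagnantRun P T p x₁ A C X) (ht : 1 ≤ t) (htT : t < T) (ω : Ω) :
    X (t + 1) i ω = move p (coeffAt A C i t ω) (X t i ω) :=
  h.update t ht htT i ω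

theorem measurable_past (h : IsStagnantRun P T p x₁ A C X) (ht : 1 ≤ t) (htT : t ≤ T) :
    Measurable[past x₁ A C t] (X t i) := by
  induction t, ht using Nat.le_induction with
  | base =>
    rw [funext (h.init i)]
    have hinit : Measurable[past x₁ A C 1] fun ω i => x₁ i ω :=
      (comap_measurable _).mono le_sup_left le_rfl
    exact (measurable_pi_apply i).comp hinit
  | succ t ht ih =>
    rw [funext (h.move_coeffAt (i := i) ht htT)]
    exact (continuous_move p).measurable.comp ((measurable_coeffAt_past t.lt_succ_self).prodMk
      ((ih (Nat.le_of_succ_le htT)).mono (past_mono t.le_succ) le_rfl))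

theorem indep_init_coeffFamily (h : IsStagnantRun P T p x₁ A C X) :
    Indep (MeasurableSpace.comap (fun ω i => x₁ i ω) inferInstance)
      (⨆ q, MeasurableSpace.comap (coeffFamily A C q) inferInstance) P := by
  refine indep_of_indep_of_le_right h.indep_init (iSup_le fun q => Measurable.comap_le ?_)
  have hcoeff := comap_measurable (m := inferInstance) fun ω =>
    ((fun t i k j => A t i k j ω : ℕ → Fin N → Fin 3 → Fin D → ℝ),
      (fun t i k j => C t i k j ω : ℕ → Fin N → Fin 3 → Fin D → ℝ))
  rcases q with ⟨t, i, k, j⟩ | ⟨t, i, k, j⟩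
  · exact (by fun_prop : Measurable fun z : (ℕ → Fin N → Fin 3 → Fin D → ℝ) ×
      (ℕ → Fin N → Fin 3 → Fin D → ℝ) => z.1 t i k j).comp hcoeff
  · exact (by fun_prop : Measurable fun z : (ℕ → Fin N → Fin 3 → Fin D → ℝ) ×
      (ℕ → Fin N → Fin 3 → Fin D → ℝ) => z.2 t i k j).comp hcoeff

theorem indep_past_coeffAt [IsProbabilityMeasure P] (h : IsStagnantRun P T p x₁ A C X) (i : Fin N)
    (t : ℕ) :
    Indep (past x₁ A C t) (MeasurableSpace.comap (coeffAt A C i t) inferInstance) P := by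
  let σ := fun q => MeasurableSpace.comap (coeffFamily A C q) inferInstance
  have hσ : ∀ q, σ q ≤ (inferInstance : MeasurableSpace Ω) :=
    fun q => (h.measurable_coeffFamily q).comap_le
  have hdisj : Disjoint {q | coeffTime (D := D) (N := N) q < t} {q | coeffTime q = t} :=
    Set.disjoint_left.2 fun q hlt heq => hlt.ne heq
  refine indep_of_indep_of_le_right ?_ comap_coeffAt_le
  refine indep_sup_left_of_indep_sup_right (measurable_pi_lambda _ h.measurable_init).comap_le
    (iSup₂_le fun q _ => hσ q) (iSup₂_le fun q _ => hσ q) ?_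
    (indep_iSup_of_disjoint hσ h.indep_coeff hdisj)
  exact indep_of_indep_of_le_right h.indep_init_coeffFamily
    (sup_le (iSup₂_le fun q _ => le_iSup σ q) (iSup₂_le fun q _ => le_iSup σ q))

theorem measureReal_coeffAt_mem_pi [IsProbabilityMeasure P] (h : IsStagnantRun P T p x₁ A C X)
    (i : Fin N) (t : ℕ) {S S' : Fin 3 → Fin D → Set ℝ} (hS : ∀ k j, MeasurableSet (S k j))
    (hS' : ∀ k j, MeasurableSet (S' k j)) :
    P.real (coeffAt A C i t ⁻¹' ((Set.univ.pi fun k => Set.univ.pi (S k)) ×ˢ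
        (Set.univ.pi fun k => Set.univ.pi (S' k)))) =
      (∏ q : Fin 3 × Fin D, P.real (A t i q.1 q.2 ⁻¹' S q.1 q.2)) *
        ∏ q : Fin 3 × Fin D, P.real (C t i q.1 q.2 ⁻¹' S' q.1 q.2) := by
  let g : (Fin 3 × Fin D) ⊕ (Fin 3 × Fin D) →
      (ℕ × Fin N × Fin 3 × Fin D) ⊕ (ℕ × Fin N × Fin 3 × Fin D) :=
    Sum.map (fun q => (t, i, q)) (fun q => (t, i, q))
  have hg : Function.Injective g := by
    refine Function.Injective.sumMap ?_ ?_ <;>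
    · intro q q' hq
      simpa using hq
  let B : (Fin 3 × Fin D) ⊕ (Fin 3 × Fin D) → Set ℝ :=
    Sum.elim (fun q => S q.1 q.2) (fun q => S' q.1 q.2)
  have hB : ∀ q ∈ Finset.univ, MeasurableSet (B q) := by
    rintro (q | q) -
    exacts [hS q.1 q.2, hS' q.1 q.2]
  have hind := (h.indep_coeff.precomp hg).measure_inter_preimage_eq_mul Finset.univ hB
  have hset : coeffAt A C i t ⁻¹' ((Set.univ.pi fun k => Set.univ.pi (S k)) ×ˢ
      (Set.univ.pi fun k => Set.univ.pi (S' k))) =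
        ⋂ q ∈ Finset.univ, coeffFamily A C (g q) ⁻¹' B q := by
    ext ω
    simp [coeffAt, g, B]
  rw [hset, measureReal_def, hind, ENNReal.toReal_prod, Fintype.prod_sum_type]
  rfl

end IsStagnantRun

theorem exists_le_measureReal_coeffAt_mem [IsProbabilityMeasure P] (x₁ : Fin N → Ω → Fin D → ℝ)
    (i : Fin N) {u : Coeff D} (hu : u ∈ coeffRange D) {V : Set (Coeff D)} (hV : V ∈ 𝓝 u) :
    ∃ δ > 0, ∀ (T : ℕ) (A C : ℕ → Fin N → Fin 3 → Fin D → Ω → ℝ) (X : ℕ → Fin N → Ω → Fin D → ℝ),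
      IsStagnantRun P T p x₁ A C X → ∀ t, 1 ≤ t → 4 * t ≤ T →
        δ ≤ P.real (coeffAt A C i t ⁻¹' V) := by
  obtain ⟨r, hr, hball⟩ := Metric.mem_nhds_iff.1 hV
  have hpos : ∀ {a b x : ℝ}, a < b → x ∈ Set.Icc a b →
      0 < volume.real (Metric.ball x r ∩ Set.Icc a b) / 4 := fun hab hx =>
    div_pos (volume_ball_inter_Icc_pos hab hx hr) (by norm_num)
  refine ⟨(∏ q : Fin 3 × Fin D,
      volume.real (Metric.ball (u.1 q.1 q.2) r ∩ Set.Icc (-(3 / 2)) (3 / 2)) / 4) *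
    ∏ q : Fin 3 × Fin D, volume.real (Metric.ball (u.2 q.1 q.2) r ∩ Set.Icc 0 2) / 4,
    mul_pos (Finset.prod_pos fun q _ => hpos (by norm_num) (hu.1 q.1 q.2))
      (Finset.prod_pos fun q _ => hpos (by norm_num) (hu.2 q.1 q.2)),
    fun T A C X h t ht htT => ?_⟩
  have hctrl : 3 / 2 ≤ control T t := three_halves_le_control (by omega) htT
  have hle : ∀ {Y : Ω → ℝ} {a b a' b' x : ℝ}, a' < b' → b' - a' ≤ 4 → a' ≤ a → b ≤ b' →
      pdf.IsUniform Y (Set.Icc a' b') P volume →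
      volume.real (Metric.ball x r ∩ Set.Icc a b) / 4 ≤ P.real (Y ⁻¹' Metric.ball x r) := by
    intro Y a b a' b' x hlt hlen ha hb hY
    have hvol := volume_inter_Icc_le_of_isUniform hlt hY (Set.Icc_subset_Icc ha hb)
      (Metric.isOpen_ball (x := x) (ε := r)).measurableSet
    have := mul_le_mul_of_nonneg_right hlen (measureReal_nonneg (μ := P)
      (s := Y ⁻¹' Metric.ball x r))
    linarith
  refine le_trans ?_ (measureReal_mono (Set.preimage_mono hball))
  rw [show u = (u.1, u.2) from rfl, ← ball_prod_same, ball_pi _ hr, ball_pi _ hr]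
  simp only [ball_pi _ hr]
  rw [h.measureReal_coeffAt_mem_pi i t (fun _ _ => Metric.isOpen_ball.measurableSet)
    (fun _ _ => Metric.isOpen_ball.measurableSet)]
  have hctrl' := control_le_two T t
  gcongr with q _ q _
  · exact hle (by linarith) (by linarith) (by linarith) hctrl
      (h.uniform_A t ht (by omega) i q.1 q.2)
  · exact hle (by norm_num) (by norm_num) le_rfl le_rfl (h.uniform_C t ht (by omega) i q.1 q.2)

end Run

section SecondMoment

variable {Ω : Type*} [MeasurableSpace Ω] {P : Measure Ω} {D N T : ℕ}
  {p : Fin 3 → Fin D → ℝ} {x₁ : Fin N → Ω → Fin D → ℝ}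
  {A C : ℕ → Fin N → Fin 3 → Fin D → Ω → ℝ} {X : ℕ → Fin N → Ω → Fin D → ℝ}
  {i : Fin N} {t : ℕ} {x : Fin D → ℝ} {j : Fin D} {k l : Fin 3} {b : ℝ}

/-- The random displacement that coordinate `j` of leader `k` contributes, in iteration `t`, to
the next position of agent `i` if that agent is at `x`. -/
def displacement (p : Fin 3 → Fin D → ℝ) (A C : ℕ → Fin N → Fin 3 → Fin D → Ω → ℝ) (i : Fin N)
    (t : ℕ) (x : Fin D → ℝ) (j : Fin D) (k : Fin 3) (ω : Ω) : ℝ :=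
  A t i k j ω * |C t i k j ω * p k j - x j|

theorem move_coeffAt_sub_center {Ω : Type*} {A C : ℕ → Fin N → Fin 3 → Fin D → Ω → ℝ} (ω : Ω) :
    move p (coeffAt A C i t ω) x j - center p j = 1 / 3 * ∑ k, displacement p A C i t x j k ω := by
  simp only [move, step, center, coeffAt, displacement, Finset.sum_add_distrib]
  ring

theorem abs_mul_sub_le_of_mem_Icc {c u z : ℝ} (hc : c ∈ Set.Icc (0 : ℝ) 2) :
    |c * u - z| ≤ 2 * |u| + |z| := by
  calc |c * u - z| ≤ |c * u| + |z| := abs_sub _ _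
    _ ≤ 2 * |u| + |z| := by
      rw [abs_mul, abs_of_nonneg hc.1]
      gcongr
      exact hc.2

namespace IsStagnantRun

theorem measurable_abs_mul_sub (h : IsStagnantRun P T p x₁ A C X) :
    Measurable fun ω => |C t i k j ω * p k j - x j| :=
  (((h.measurable_C t i k j).mul_const _).sub_const _).abs

theorem ae_abs_mul_sub_le (h : IsStagnantRun P T p x₁ A C X) (ht : 1 ≤ t) (htT : t < T)
    (hb : 2 * |p k j| + |x j| ≤ b) : ∀ᵐ ω ∂P, |(|C t i k j ω * p k j - x j|)| ≤ b := by
  filter_upwards [ae_mem_Icc_of_isUniform (h.measurable_C t i k j) (h.uniform_C t ht htT i k j)]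
    with ω hω
  rw [abs_abs]
  exact (abs_mul_sub_le_of_mem_Icc hω).trans hb

theorem indepFun_abs_mul_sub (h : IsStagnantRun P T p x₁ A C X) :
    IndepFun (A t i k j) (fun ω => |C t i k j ω * p k j - x j|) P :=
  (h.indep_coeff.indepFun (i := .inl (t, i, k, j)) (j := .inr (t, i, k, j)) (by simp)).comp
    measurable_id (by fun_prop : Measurable fun r : ℝ => |r * p k j - x j|)

theorem indepFun_displacement (h : IsStagnantRun P T p x₁ A C X) (hkl : k ≠ l) :
    IndepFun (displacement p A C i t x j k) (displacement p A C i t x j l) P :=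
  (h.indep_coeff.indepFun_prodMk_prodMk h.measurable_coeffFamily (.inl (t, i, k, j))
    (.inr (t, i, k, j)) (.inl (t, i, l, j)) (.inr (t, i, l, j))
    (by simp [hkl]) (by simp) (by simp) (by simp [hkl])).comp
    (by fun_prop : Measurable fun r : ℝ × ℝ => r.1 * |r.2 * p k j - x j|)
    (by fun_prop : Measurable fun r : ℝ × ℝ => r.1 * |r.2 * p l j - x j|)

theorem memLp_displacement [IsProbabilityMeasure P] (h : IsStagnantRun P T p x₁ A C X)
    (ht : 1 ≤ t) (htT : t < T) : MemLp (displacement p A C i t x j k) 2 P :=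
  memLp_mul_of_isUniform_symm (h.measurable_A t i k j) h.measurable_abs_mul_sub
    (h.uniform_A t ht htT i k j) (h.ae_abs_mul_sub_le ht htT le_rfl)

theorem integral_sq_displacement_le [IsProbabilityMeasure P] (h : IsStagnantRun P T p x₁ A C X)
    (ht : 1 ≤ t) (htT : t < T) (hb : 2 * |p k j| + |x j| ≤ b) :
    ∫ ω, displacement p A C i t x j k ω ^ 2 ∂P ≤ 4 / 3 * b ^ 2 := by
  have hpos := control_pos htT
  calc ∫ ω, displacement p A C i t x j k ω ^ 2 ∂P ≤ control T t ^ 2 / 3 * b ^ 2 :=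
        integral_mul_sq_le_of_isUniform_symm hpos (h.measurable_A t i k j)
          h.measurable_abs_mul_sub (h.uniform_A t ht htT i k j) h.indepFun_abs_mul_sub
          (h.ae_abs_mul_sub_le ht htT hb)
    _ ≤ 2 ^ 2 / 3 * b ^ 2 := by
        gcongr
        exact control_le_two T t
    _ = 4 / 3 * b ^ 2 := by norm_num

theorem integral_sq_sum_displacement_le [IsProbabilityMeasure P]
    (h : IsStagnantRun P T p x₁ A C X) (ht : 1 ≤ t) (htT : t < T)
    (hb : ∀ k, 2 * |p k j| + |x j| ≤ b) :
    ∫ ω, (∑ k, displacement p A C i t x j k ω) ^ 2 ∂P ≤ 4 * b ^ 2 := by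
  rw [integral_sq_sum_eq_sum_integral_sq (fun k _ => h.memLp_displacement ht htT)
    (fun k _ => integral_mul_of_isUniform_symm (control_pos htT) (h.measurable_A t i k j)
      h.measurable_abs_mul_sub (h.uniform_A t ht htT i k j) h.indepFun_abs_mul_sub)
    (fun k _ l _ hkl => h.indepFun_displacement hkl)]
  calc ∑ k, ∫ ω, displacement p A C i t x j k ω ^ 2 ∂P ≤ ∑ _k : Fin 3, 4 / 3 * b ^ 2 :=
        Finset.sum_le_sum fun k _ => h.integral_sq_displacement_le ht htT (hb k)
    _ = 4 * b ^ 2 := by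
        rw [Finset.sum_const, Finset.card_univ, Fintype.card_fin, nsmul_eq_mul]
        push_cast
        ring

theorem lintegral_sq_move_sub_center_le [IsProbabilityMeasure P]
    (h : IsStagnantRun P T p x₁ A C X) (i : Fin N) (ht : 1 ≤ t) (htT : t < T) {q : ℝ}
    (hq : ∀ k, 2 * |p k j| + |center p j| ≤ q) (x : Fin D → ℝ) :
    ∫⁻ ω, ENNReal.ofReal ((move p (coeffAt A C i t ω) x j - center p j) ^ 2) ∂P ≤
      ENNReal.ofReal (8 / 9 * ((x j - center p j) ^ 2 + q ^ 2)) := by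
  have hb : ∀ k, 2 * |p k j| + |x j| ≤ |x j - center p j| + q := fun k => by
    have := abs_sub_abs_le_abs_sub (x j) (center p j)
    linarith [hq k]
  have hLp : MemLp (fun ω => ∑ k, displacement p A C i t x j k ω) 2 P :=
    memLp_finsetSum _ fun k _ => h.memLp_displacement ht htT
  simp only [move_coeffAt_sub_center, mul_pow]
  rw [← ofReal_integral_eq_lintegral_ofReal (hLp.integrable_sq.const_mul _)
    (ae_of_all _ fun ω => by positivity), integral_const_mul]
  refine ENNReal.ofReal_le_ofReal ?_
  calc (1 / 3 : ℝ) ^ 2 * ∫ ω, (∑ k, displacement p A C i t x j k ω) ^ 2 ∂P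
      ≤ (1 / 3) ^ 2 * (4 * (|x j - center p j| + q) ^ 2) := by
        gcongr
        exact h.integral_sq_sum_displacement_le ht htT hb
    _ ≤ (1 / 3) ^ 2 * (4 * (2 * (|x j - center p j| ^ 2 + q ^ 2))) := by
        gcongr
        exact add_sq_le
    _ = 8 / 9 * ((x j - center p j) ^ 2 + q ^ 2) := by
        rw [sq_abs]
        ring

theorem setLIntegral_sq_succ_sub_center_le [IsProbabilityMeasure P]
    (h : IsStagnantRun P T p x₁ A C X) {q : ℝ} (hq : ∀ k, 2 * |p k j| + |center p j| ≤ q)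
    (ht : 1 ≤ t) (htT : t < T) {E : Set Ω} (hE : MeasurableSet[past x₁ A C t] E) :
    ∫⁻ ω in E, ENNReal.ofReal ((X (t + 1) i ω j - center p j) ^ 2) ∂P ≤
      ENNReal.ofReal (8 / 9) * (∫⁻ ω in E, ENNReal.ofReal ((X t i ω j - center p j) ^ 2) ∂P
        + ENNReal.ofReal (q ^ 2)) := by
  let f : (Fin D → ℝ) → ENNReal := fun x => ENNReal.ofReal ((x j - center p j) ^ 2)
  have hf : Measurable f := by fun_prop
  have hfX : Measurable fun ω => f (X t i ω) :=
    hf.comp ((h.measurable_past ht htT.le).mono (h.past_le t) le_rfl)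
  calc ∫⁻ ω in E, f (X (t + 1) i ω) ∂P
      = ∫⁻ ω in E, f (move p (coeffAt A C i t ω) (X t i ω)) ∂P := by
        simp only [h.move_coeffAt ht htT]
    _ = ∫⁻ ω in E, ∫⁻ ω', f (move p (coeffAt A C i t ω') (X t i ω)) ∂P ∂P :=
        setLIntegral_comp_of_indep (g := fun x u => f (move p u x)) (h.past_le t)
          (h.measurable_past ht htT.le) (h.measurable_coeffAt i t) (h.indep_past_coeffAt i t) hE
          (hf.comp ((continuous_move p).measurable.comp measurable_swap))
    _ ≤ ∫⁻ ω in E, ENNReal.ofReal (8 / 9) * (f (X t i ω) + ENNReal.ofReal (q ^ 2)) ∂P := by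
        refine lintegral_mono fun ω =>
          (h.lintegral_sq_move_sub_center_le i ht htT hq _).trans_eq ?_
        rw [ENNReal.ofReal_mul (by norm_num), ENNReal.ofReal_add (sq_nonneg _) (sq_nonneg _)]
    _ = ENNReal.ofReal (8 / 9) *
          (∫⁻ ω in E, f (X t i ω) ∂P + ENNReal.ofReal (q ^ 2) * P E) := by
        rw [lintegral_const_mul _ (hfX.add_const _), lintegral_add_left hfX, setLIntegral_const]
    _ ≤ ENNReal.ofReal (8 / 9) * (∫⁻ ω in E, f (X t i ω) ∂P + ENNReal.ofReal (q ^ 2)) := by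
        gcongr
        exact mul_le_of_le_one_right zero_le prob_le_one

theorem setLIntegral_sq_sub_center_le [IsProbabilityMeasure P] (h : IsStagnantRun P T p x₁ A C X)
    {q L : ℝ} (hq : ∀ k, 2 * |p k j| + |center p j| ≤ q) (hL : 8 * q ^ 2 ≤ L) {E : Set Ω}
    (hE : MeasurableSet[past x₁ A C 1] E) (hEL : ∀ ω ∈ E, (x₁ i ω j - center p j) ^ 2 ≤ L)
    (ht : 1 ≤ t) (htT : t ≤ T) :
    ∫⁻ ω in E, ENNReal.ofReal ((X t i ω j - center p j) ^ 2) ∂P ≤ ENNReal.ofReal L := by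
  induction t, ht using Nat.le_induction with
  | base =>
    calc ∫⁻ ω in E, ENNReal.ofReal ((X 1 i ω j - center p j) ^ 2) ∂P
        ≤ ∫⁻ _ in E, ENNReal.ofReal L ∂P :=
          setLIntegral_mono' (h.past_le 1 _ hE) fun ω hω => by
            rw [h.init]
            exact ENNReal.ofReal_le_ofReal (hEL ω hω)
      _ ≤ ENNReal.ofReal L := by
          rw [setLIntegral_const]
          exact mul_le_of_le_one_right zero_le prob_le_one
  | succ t ht ih =>
    calc ∫⁻ ω in E, ENNReal.ofReal ((X (t + 1) i ω j - center p j) ^ 2) ∂P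
        ≤ ENNReal.ofReal (8 / 9) * (ENNReal.ofReal L + ENNReal.ofReal (q ^ 2)) := by
          refine (h.setLIntegral_sq_succ_sub_center_le hq ht htT (past_mono ht _ hE)).trans ?_
          gcongr
          exact ih (Nat.le_of_succ_le htT)
      _ = ENNReal.ofReal (8 / 9 * (L + q ^ 2)) := by
          rw [← ENNReal.ofReal_add (by nlinarith) (sq_nonneg q), ← ENNReal.ofReal_mul (by norm_num)]
      _ ≤ ENNReal.ofReal L := ENNReal.ofReal_le_ofReal (by linarith)

end IsStagnantRun

end SecondMoment

section Tightness

variable {Ω : Type*} [MeasurableSpace Ω] {P : Measure Ω} [IsProbabilityMeasure P] {D N T : ℕ}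
  {p : Fin 3 → Fin D → ℝ} {x₁ : Fin N → Ω → Fin D → ℝ} {i : Fin N} {t : ℕ}

theorem IsStagnantRun.measure_inter_notMem_closedBall_le
    {A C : ℕ → Fin N → Fin 3 → Fin D → Ω → ℝ} {X : ℕ → Fin N → Ω → Fin D → ℝ}
    (h : IsStagnantRun P T p x₁ A C X) {q L M : ℝ}
    (hq : ∀ k j, 2 * |p k j| + |center p j| ≤ q) (hL : 8 * q ^ 2 ≤ L) {E : Set Ω}
    (hE : MeasurableSet[past x₁ A C 1] E) (hEL : ∀ ω ∈ E, ∀ j, (x₁ i ω j - center p j) ^ 2 ≤ L)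
    (hM : 0 < M) (ht : 1 ≤ t) (htT : t ≤ T) :
    P (E ∩ X t i ⁻¹' (Metric.closedBall (center p) M)ᶜ) ≤ ENNReal.ofReal (D * (L / M ^ 2)) := by
  have hX : Measurable (X t i) := (h.measurable_past ht htT).mono (h.past_le t) le_rfl
  have hcover : X t i ⁻¹' (Metric.closedBall (center p) M)ᶜ ⊆
      ⋃ j, {ω | ENNReal.ofReal (M ^ 2) ≤ ENNReal.ofReal ((X t i ω j - center p j) ^ 2)} := by
    intro ω hω
    rw [Set.mem_preimage, Set.mem_compl_iff, closedBall_pi _ hM.le, Set.mem_univ_pi,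
      not_forall] at hω
    obtain ⟨j, hj⟩ := hω
    refine Set.mem_iUnion.2 ⟨j, ENNReal.ofReal_le_ofReal (sq_le_sq.2 ?_)⟩
    rw [abs_of_pos hM]
    exact (not_le.1 hj).le
  calc P (E ∩ X t i ⁻¹' (Metric.closedBall (center p) M)ᶜ)
      = P.restrict E (X t i ⁻¹' (Metric.closedBall (center p) M)ᶜ) := by
        rw [Measure.restrict_apply' (h.past_le 1 _ hE), Set.inter_comm]
    _ ≤ ∑ j, P.restrict E
          {ω | ENNReal.ofReal (M ^ 2) ≤ ENNReal.ofReal ((X t i ω j - center p j) ^ 2)} :=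
        (measure_mono hcover).trans (measure_iUnion_fintype_le _ _)
    _ ≤ ∑ _j : Fin D, ENNReal.ofReal (L / M ^ 2) := by
        refine Finset.sum_le_sum fun j _ => ?_
        rw [ENNReal.ofReal_div_of_pos (by positivity)]
        refine (meas_ge_le_lintegral_div (by fun_prop) (by simpa using hM.ne') (by simp)).trans ?_
        gcongr
        exact h.setLIntegral_sq_sub_center_le (fun k => hq k j) hL hE (fun ω hω => hEL ω hω j)
          ht htT
    _ = ENNReal.ofReal (D * (L / M ^ 2)) := by
        simp [ENNReal.ofReal_mul]

theorem exists_measureReal_notMem_closedBall_le (p : Fin 3 → Fin D → ℝ) (hx₁ : Measurable (x₁ i))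
    {ε : ℝ} (hε : 0 < ε) :
    ∃ M, ∀ (T : ℕ) (A C : ℕ → Fin N → Fin 3 → Fin D → Ω → ℝ) (X : ℕ → Fin N → Ω → Fin D → ℝ),
      IsStagnantRun P T p x₁ A C X → ∀ t, 1 ≤ t → t ≤ T →
        P.real (X t i ⁻¹' (Metric.closedBall (center p) M)ᶜ) ≤ ε := by
  obtain ⟨q, hq⟩ := Finite.exists_le fun kj : Fin 3 × Fin D =>
    2 * |p kj.1 kj.2| + |center p kj.2|
  obtain ⟨R, hR⟩ := exists_measure_preimage_compl_closedBall_le (P := P) hx₁ (center p)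
    (ENNReal.ofReal_pos.2 (half_pos hε))
  obtain ⟨M, hM, hMpos⟩ : ∃ M : ℝ, (D : ℝ) * ((R ^ 2 + 8 * q ^ 2) / M ^ 2) ≤ ε / 2 ∧ 0 < M := by
    have hlim : Tendsto (fun M : ℝ => (D : ℝ) * ((R ^ 2 + 8 * q ^ 2) / M ^ 2)) atTop
        (𝓝 ((D : ℝ) * 0)) :=
      (tendsto_const_nhds.div_atTop (tendsto_pow_atTop two_ne_zero)).const_mul _
    rw [mul_zero] at hlim
    exact ((hlim.eventually_le_const (half_pos hε)).and (eventually_gt_atTop 0)).exists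
  refine ⟨M, fun T A C X h t ht htT => ENNReal.toReal_le_of_le_ofReal hε.le ?_⟩
  let E := x₁ i ⁻¹' Metric.closedBall (center p) R
  have hE : MeasurableSet[past x₁ A C 1] E := by
    have hinit : Measurable[past x₁ A C 1] (x₁ i) := by
      rw [← funext (h.init i)]
      exact h.measurable_past le_rfl (ht.trans htT)
    exact hinit Metric.isClosed_closedBall.measurableSet
  have hEL : ∀ ω ∈ E, ∀ j, (x₁ i ω j - center p j) ^ 2 ≤ R ^ 2 + 8 * q ^ 2 := fun ω hω j => by
    have hdist : |x₁ i ω j - center p j| ≤ R := (dist_le_pi_dist _ _ j).trans hω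
    have := sq_le_sq' (abs_le.1 hdist).1 (abs_le.1 hdist).2
    nlinarith
  calc P (X t i ⁻¹' (Metric.closedBall (center p) M)ᶜ)
      ≤ P Eᶜ + P (E ∩ X t i ⁻¹' (Metric.closedBall (center p) M)ᶜ) := by
        refine (measure_mono fun ω hω => ?_).trans (measure_union_le _ _)
        exact (em (ω ∈ E)).symm.imp id fun hωE => ⟨hωE, hω⟩
    _ ≤ ENNReal.ofReal (ε / 2) + ENNReal.ofReal (ε / 2) := by
        refine add_le_add hR ((h.measure_inter_notMem_closedBall_le (fun k j => hq (k, j))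
          (by nlinarith) hE hEL hMpos ht htT).trans (ENNReal.ofReal_le_ofReal hM))
    _ = ENNReal.ofReal ε := by
        rw [← ENNReal.ofReal_add (half_pos hε).le (half_pos hε).le, add_halves]

end Tightness

section Reachability

variable {Ω : Type*} [MeasurableSpace Ω] {P : Measure Ω} {D N : ℕ} {p : Fin 3 → Fin D → ℝ}
  {x₁ : Fin N → Ω → Fin D → ℝ} {i : Fin N} {n : ℕ} {W W' S : Set (Fin D → ℝ)}

/-- Whenever agent `i` is in `W` during the first quarter of a run, it is in `S` after `n` further
iterations with conditional probability, given the past, at least some `δ > 0` that depends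
neither on the run nor on the iteration. Conditioning is expressed through the events `E` of the
past on which the agent is in `W`. -/
def UniformlyReaches (P : Measure Ω) (p : Fin 3 → Fin D → ℝ) (x₁ : Fin N → Ω → Fin D → ℝ)
    (i : Fin N) (n : ℕ) (W S : Set (Fin D → ℝ)) : Prop :=
  ∃ δ > 0, ∀ (T : ℕ) (A C : ℕ → Fin N → Fin 3 → Fin D → Ω → ℝ) (X : ℕ → Fin N → Ω → Fin D → ℝ),
    IsStagnantRun P T p x₁ A C X → ∀ t, 1 ≤ t → 4 * (t + n) ≤ T →
      ∀ E, MeasurableSet[past x₁ A C t] E → E ⊆ X t i ⁻¹' W →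
        δ * P.real E ≤ P.real (E ∩ X (t + n) i ⁻¹' S)

namespace UniformlyReaches

theorem mono (hW : W ⊆ W') (h : UniformlyReaches P p x₁ i n W' S) :
    UniformlyReaches P p x₁ i n W S := by
  obtain ⟨δ, hδ, h⟩ := h
  exact ⟨δ, hδ, fun T A C X hX t ht htT E hE hEW =>
    h T A C X hX t ht htT E hE (hEW.trans (Set.preimage_mono hW))⟩

theorem empty : UniformlyReaches P p x₁ i n ∅ S := by
  refine ⟨1, one_pos, fun T A C X _ t _ _ E _ hE => ?_⟩
  rw [Set.preimage_empty, Set.subset_empty_iff] at hE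
  simp only [hE, measureReal_empty, mul_zero, measureReal_nonneg]

theorem refl : UniformlyReaches P p x₁ i 0 S S := by
  refine ⟨1, one_pos, fun T A C X _ t _ _ E _ hE => ?_⟩
  rw [add_zero, Set.inter_eq_left.2 hE, one_mul]

theorem union [IsFiniteMeasure P] (hW : MeasurableSet W)
    (h : UniformlyReaches P p x₁ i n W S) (h' : UniformlyReaches P p x₁ i n W' S) :
    UniformlyReaches P p x₁ i n (W ∪ W') S := by
  obtain ⟨δ, hδ, h⟩ := h
  obtain ⟨δ', hδ', h'⟩ := h'
  refine ⟨min δ δ', lt_min hδ hδ', fun T A C X hX t ht htT E hE hEW => ?_⟩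
  have hXW : MeasurableSet[past x₁ A C t] (X t i ⁻¹' W) := hX.measurable_past ht (by omega) hW
  have hdiff : E \ X t i ⁻¹' W ⊆ X t i ⁻¹' W' := fun ω hω => (hEW hω.1).resolve_left hω.2
  have hsplit := measureReal_inter_add_sdiff (μ := P) (s := E) (hX.past_le t _ hXW)
  calc min δ δ' * P.real E
      = min δ δ' * P.real (E ∩ X t i ⁻¹' W) + min δ δ' * P.real (E \ X t i ⁻¹' W) := by
        rw [← hsplit, mul_add]
    _ ≤ δ * P.real (E ∩ X t i ⁻¹' W) + δ' * P.real (E \ X t i ⁻¹' W) := by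
        gcongr
        exacts [min_le_left .., min_le_right ..]
    _ ≤ P.real ((E ∩ X t i ⁻¹' W) ∩ X (t + n) i ⁻¹' S) +
          P.real ((E \ X t i ⁻¹' W) ∩ X (t + n) i ⁻¹' S) :=
        add_le_add (h T A C X hX t ht htT _ (hE.inter hXW) Set.inter_subset_right)
          (h' T A C X hX t ht htT _ (hE.diff hXW) hdiff)
    _ = P.real (E ∩ X (t + n) i ⁻¹' S) := by
        rw [Set.inter_right_comm, ← Set.inter_sdiff_right_comm,
          measureReal_inter_add_sdiff (hX.past_le t _ hXW)]

theorem exists_mem_nhds_succ [IsProbabilityMeasure P] {u : Coeff D} (hu : u ∈ coeffRange D)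
    {x : Fin D → ℝ} (hux : ∀ᶠ q in 𝓝 (u, x), move p q.1 q.2 ∈ W)
    (h : UniformlyReaches P p x₁ i n W S) : ∃ U ∈ 𝓝 x, UniformlyReaches P p x₁ i (n + 1) U S := by
  obtain ⟨V, U, hV, huV, hU, hxU, hVU⟩ := mem_nhds_prod_iff'.1 hux
  obtain ⟨δ, hδ, h⟩ := h
  obtain ⟨δ', hδ', hcoeff⟩ := exists_le_measureReal_coeffAt_mem (P := P) x₁ i hu (hV.mem_nhds huV)
  refine ⟨U, hU.mem_nhds hxU, δ * δ', mul_pos hδ hδ', fun T A C X hX t ht htT E hE hEU => ?_⟩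
  let F := E ∩ coeffAt A C i t ⁻¹' V
  have hF : MeasurableSet[past x₁ A C (t + 1)] F :=
    (past_mono t.le_succ _ hE).inter (measurable_coeffAt_past t.lt_succ_self hV.measurableSet)
  have hFW : F ⊆ X (t + 1) i ⁻¹' W := fun ω hω => by
    rw [Set.mem_preimage, hX.move_coeffAt ht (by omega)]
    exact hVU (Set.mk_mem_prod hω.2 (hEU hω.1))
  calc δ * δ' * P.real E ≤ δ * (P.real E * P.real (coeffAt A C i t ⁻¹' V)) := by
        rw [mul_assoc, mul_comm δ']
        gcongr
        exact hcoeff T A C X hX t ht (by omega)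
    _ = δ * P.real F := by
        rw [measureReal_inter_of_indep (hX.indep_past_coeffAt i t) hE ⟨V, hV.measurableSet, rfl⟩]
    _ ≤ P.real (F ∩ X (t + 1 + n) i ⁻¹' S) :=
        h T A C X hX (t + 1) (by omega) (by omega) F hF hFW
    _ ≤ P.real (E ∩ X (t + (n + 1)) i ⁻¹' S) := by
        rw [add_right_comm, add_assoc]
        exact measureReal_mono (Set.inter_subset_inter_left _ Set.inter_subset_left)

theorem exists_mem_nhds_of_mem_iterate_robustPreimage [IsProbabilityMeasure P] {x : Fin D → ℝ}
    (hx : x ∈ (robustPreimage (move p) (coeffRange D))^[n + 1] S) :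
    ∃ U ∈ 𝓝 x, UniformlyReaches P p x₁ i (n + 1) U S := by
  induction n generalizing x with
  | zero =>
    obtain ⟨u, hu, hux⟩ := hx
    exact refl.exists_mem_nhds_succ hu hux
  | succ n ih =>
    rw [Function.iterate_succ_apply'] at hx
    obtain ⟨u, hu, hux⟩ := hx
    obtain ⟨W, hW, hWS⟩ := ih hux.self_of_nhds
    exact hWS.exists_mem_nhds_succ hu ((continuous_move p).continuousAt.eventually hW)

theorem of_isCompact [IsFiniteMeasure P] (hW : IsCompact W)
    (h : ∀ x ∈ W, ∃ U ∈ 𝓝 x, UniformlyReaches P p x₁ i n U S) :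
    UniformlyReaches P p x₁ i n W S := by
  suffices ∃ U, W ⊆ U ∧ MeasurableSet U ∧ UniformlyReaches P p x₁ i n U S by
    obtain ⟨U, hWU, -, hU⟩ := this
    exact hU.mono hWU
  refine hW.induction_on
    (p := fun s => ∃ U, s ⊆ U ∧ MeasurableSet U ∧ UniformlyReaches P p x₁ i n U S)
    ⟨∅, subset_rfl, .empty, empty⟩ ?_ ?_ fun x hx => ?_
  · rintro s s' hs ⟨U, hU, hreach⟩
    exact ⟨U, hs.trans hU, hreach⟩
  · rintro s s' ⟨U, hsU, hU, hreach⟩ ⟨U', hsU', hU', hreach'⟩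
    exact ⟨U ∪ U', Set.union_subset_union hsU hsU', hU.union hU', hreach.union hU hreach'⟩
  · obtain ⟨U, hU, hreach⟩ := h x hx
    exact ⟨interior U, mem_nhdsWithin_of_mem_nhds (interior_mem_nhds.2 hU), interior U, subset_rfl,
      isOpen_interior.measurableSet, hreach.mono interior_subset⟩

end UniformlyReaches

end Reachability

section Search

variable {Ω : Type*} [MeasurableSpace Ω] {P : Measure Ω} {D N T : ℕ} {p : Fin 3 → Fin D → ℝ}
  {x₁ : Fin N → Ω → Fin D → ℝ} {i : Fin N} {n s t : ℕ} {K S : Set (Fin D → ℝ)} {ε : ℝ}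

theorem foundBy_mono {Ω : Type*} {x : ℕ → Ω → Fin D → ℝ} (hst : s ≤ t) :
    foundBy x S s ⊆ foundBy x S t :=
  fun _ ⟨r, hr, hrs, hS⟩ => ⟨r, hr, hrs.trans hst, hS⟩

theorem IsStagnantRun.measurableSet_foundBy {A C : ℕ → Fin N → Fin 3 → Fin D → Ω → ℝ}
    {X : ℕ → Fin N → Ω → Fin D → ℝ} (h : IsStagnantRun P T p x₁ A C X) (hS : MeasurableSet S)
    (htT : t ≤ T) : MeasurableSet[past x₁ A C t] (foundBy (fun s => X s i) S t) := by
  have hunion : foundBy (fun s => X s i) S t = ⋃ s ∈ Set.Icc 1 t, X s i ⁻¹' S := by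
    ext ω
    simp [foundBy, and_assoc]
  rw [hunion]
  exact MeasurableSet.biUnion (Set.to_countable _) fun s hs =>
    past_mono hs.2 _ (h.measurable_past hs.1 (hs.2.trans htT) hS)

theorem UniformlyReaches.exists_measureReal_compl_foundBy_add_le [IsFiniteMeasure P]
    (hreach : UniformlyReaches P p x₁ i n K S) (hK : MeasurableSet K) (hS : MeasurableSet S) :
    ∃ δ > 0, δ ≤ 1 ∧ ∀ (T : ℕ) (A C : ℕ → Fin N → Fin 3 → Fin D → Ω → ℝ)
      (X : ℕ → Fin N → Ω → Fin D → ℝ), IsStagnantRun P T p x₁ A C X →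
        ∀ t, 1 ≤ t → 4 * (t + n) ≤ T → P.real (X t i ⁻¹' Kᶜ) ≤ ε →
          P.real (foundBy (fun s => X s i) S (t + n))ᶜ - ε ≤
            (1 - δ) * (P.real (foundBy (fun s => X s i) S t)ᶜ - ε) := by
  obtain ⟨δ, hδ, hreach⟩ := hreach
  refine ⟨min δ 1, lt_min hδ one_pos, min_le_right _ _, fun T A C X h t ht htT htight => ?_⟩
  let G := fun t => (foundBy (fun s => X s i) S t)ᶜ
  let E := G t ∩ X t i ⁻¹' K
  have hGt : MeasurableSet[past x₁ A C t] (G t) := (h.measurableSet_foundBy hS (by omega)).compl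
  have hE : MeasurableSet[past x₁ A C t] E := hGt.inter (h.measurable_past ht (by omega) hK)
  have hGtn : MeasurableSet (G (t + n)) :=
    h.past_le _ _ (h.measurableSet_foundBy hS (by omega)).compl
  have hstay : P.real (G t) ≤ P.real E + ε := by
    have hcover : G t ⊆ E ∪ X t i ⁻¹' Kᶜ := fun ω hω =>
      (em (X t i ω ∈ K)).imp (fun hωK => ⟨hω, hωK⟩) id
    exact (measureReal_mono hcover).trans ((measureReal_union_le _ _).trans (by gcongr))
  have hfind : P.real (G (t + n)) + P.real (E ∩ X (t + n) i ⁻¹' S) ≤ P.real (G t) := by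
    have hdisj : Disjoint (E ∩ X (t + n) i ⁻¹' S) (G (t + n)) :=
      Set.disjoint_left.2 fun ω hω hωG => hωG ⟨t + n, by omega, le_rfl, hω.2⟩
    rw [add_comm, ← measureReal_union hdisj hGtn]
    exact measureReal_mono (Set.union_subset (fun ω hω => hω.1.1)
      (Set.compl_subset_compl.2 (foundBy_mono (Nat.le_add_right t n))))
  have hδE : min δ 1 * P.real E ≤ P.real (E ∩ X (t + n) i ⁻¹' S) :=
    (mul_le_mul_of_nonneg_right (min_le_left _ _) measureReal_nonneg).trans
      (hreach T A C X h t ht htT E hE Set.inter_subset_right)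
  have := mul_le_mul_of_nonneg_left hstay (lt_min hδ one_pos).le
  linarith

theorem UniformlyReaches.exists_measureReal_compl_foundBy_le [IsProbabilityMeasure P]
    (hreach : UniformlyReaches P p x₁ i n K S) (hK : MeasurableSet K) (hS : MeasurableSet S)
    (hε : 0 ≤ ε) :
    ∃ δ > 0, ∀ (T : ℕ) (A C : ℕ → Fin N → Fin 3 → Fin D → Ω → ℝ)
      (X : ℕ → Fin N → Ω → Fin D → ℝ), IsStagnantRun P T p x₁ A C X →
        (∀ t, 1 ≤ t → t ≤ T → P.real (X t i ⁻¹' Kᶜ) ≤ ε) →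
          ∀ k, 4 * (1 + k * n) ≤ T →
            P.real (foundBy (fun s => X s i) S (1 + k * n))ᶜ ≤ (1 - δ) ^ k + ε := by
  obtain ⟨δ, hδ, hδ1, hcontract⟩ :=
    hreach.exists_measureReal_compl_foundBy_add_le (ε := ε) hK hS
  refine ⟨δ, hδ, fun T A C X h htight k hk => ?_⟩
  induction k with
  | zero => exact measureReal_le_one.trans (by simpa using hε)
  | succ k ih =>
    rw [add_one_mul, ← add_assoc] at hk ⊢
    have hle := hcontract T A C X h (1 + k * n) (by omega) hk (htight _ (by omega) (by omega))
    rw [← sub_le_iff_le_add, pow_succ']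
    exact hle.trans (mul_le_mul_of_nonneg_left (sub_le_iff_le_add.2 (ih (by omega)))
      (sub_nonneg.2 hδ1))

theorem exists_forall_measureReal_compl_foundBy_le [IsProbabilityMeasure P] {lb ub : Fin D → ℝ}
    (hbox : ∀ j, lb j < ub j) (hdeg : ∀ j, (∀ k, p k j = 0) → 0 ∈ Set.Icc (lb j) (ub j))
    (hx₁ : Measurable (x₁ i)) (hε : 0 < ε) :
    ∃ t₀, ∀ (T : ℕ) (A C : ℕ → Fin N → Fin 3 → Fin D → Ω → ℝ) (X : ℕ → Fin N → Ω → Fin D → ℝ),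
      IsStagnantRun P T p x₁ A C X → ∀ t, t₀ ≤ t → t ≤ T →
        P.real (foundBy (fun s => X s i) (Set.Icc lb ub) t)ᶜ ≤ ε := by
  obtain ⟨M, hM⟩ := exists_measureReal_notMem_closedBall_le p hx₁ (half_pos hε) (P := P)
  have hball : IsCompact (Metric.closedBall (center p) M) := isCompact_closedBall _ _
  obtain ⟨n, hn⟩ := ((tendsto_add_atTop_nat 1).eventually
    (eventually_iterate_robustPreimage_move_eq_univ hbox hdeg)).exists
  have hreach : UniformlyReaches P p x₁ i (n + 1) (Metric.closedBall (center p) M)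
      (Set.Icc lb ub) :=
    .of_isCompact hball fun x _ => UniformlyReaches.exists_mem_nhds_of_mem_iterate_robustPreimage
      (hn ▸ Set.mem_univ x)
  obtain ⟨δ, hδ, hfind⟩ := hreach.exists_measureReal_compl_foundBy_le
    hball.measurableSet measurableSet_Icc (half_pos hε).le
  obtain ⟨k, hk⟩ := exists_pow_lt_of_lt_one (half_pos hε) (sub_lt_self 1 hδ)
  refine ⟨4 * (1 + k * (n + 1)), fun T A C X h t ht htT => ?_⟩
  calc P.real (foundBy (fun s => X s i) (Set.Icc lb ub) t)ᶜ
      ≤ P.real (foundBy (fun s => X s i) (Set.Icc lb ub) (1 + k * (n + 1)))ᶜ :=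
        measureReal_mono (Set.compl_subset_compl.2 (foundBy_mono (by omega)))
    _ ≤ (1 - δ) ^ k + ε / 2 := hfind T A C X h (hM T A C X h) k (ht.trans htT)
    _ ≤ ε := by linarith

end Search

end GWO

theorem proposition2_general {Ω : Type*} [MeasurableSpace Ω] (P : Measure Ω)
    [IsProbabilityMeasure P] {D N : ℕ} (p : Fin 3 → Fin D → ℝ)
    (lb ub : Fin D → ℝ) (hbox : ∀ j, lb j < ub j)
    (hdeg : ∀ j, (∀ k, p k j = 0) → 0 ∈ Set.Icc (lb j) (ub j))
    (x₁ : Fin N → Ω → Fin D → ℝ) (i : Fin N)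
    (A C : ℕ → ℕ → Fin N → Fin 3 → Fin D → Ω → ℝ)
    (X : ℕ → ℕ → Fin N → Ω → Fin D → ℝ)
    (hX : ∀ T, GWO.IsStagnantRun P T p x₁ (A T) (C T) (X T)) :
    Tendsto (fun q : ℕ × ℕ => P.real (GWO.foundBy (fun s => X q.1 s i) (Set.Icc lb ub) q.2))
      GWO.iterToInfty (𝓝 1) := by
  have hle : ∀ q : ℕ × ℕ,
      P.real (GWO.foundBy (fun s => X q.1 s i) (Set.Icc lb ub) q.2) ≤ 1 :=
    fun _ => measureReal_le_one
  refine tendsto_order.2 ⟨fun a ha => ?_, fun a ha => Eventually.of_forall fun q =>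
    (hle q).trans_lt ha⟩
  obtain ⟨t₀, ht₀⟩ := GWO.exists_forall_measureReal_compl_foundBy_le hbox hdeg
    ((hX 0).measurable_init i) (half_pos (sub_pos.2 ha)) (P := P)
  have hlarge : ∀ᶠ q in GWO.iterToInfty, t₀ ≤ q.2 :=
    (tendsto_comap.mono_left inf_le_left).eventually (eventually_ge_atTop t₀)
  have hiter : ∀ᶠ q in GWO.iterToInfty, q.2 ≤ q.1 := mem_inf_of_right (mem_principal_self _)
  filter_upwards [hlarge, hiter] with q hq hqT
  have hfail := ht₀ q.1 _ _ _ (hX q.1) q.2 hq hqT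
  have hmeas := (hX q.1).past_le _ _ ((hX q.1).measurableSet_foundBy (i := i)
    (measurableSet_Icc (a := lb) (b := ub)) hqT)
  rw [probReal_compl_eq_one_sub hmeas] at hfail
  linarith

theorem proposition2 {Ω : Type*} [MeasurableSpace Ω] (P : Measure Ω) [IsProbabilityMeasure P]
    {D N : ℕ} (p : Fin 3 → Fin D → ℝ)
    (lb ub : Fin D → ℝ) (hbox : ∀ j, lb j < ub j)
    (hdeg : ∀ j, (∀ k, p k j = 0) → 0 ∈ Set.Icc (lb j) (ub j))
    (x₁ : Fin N → Ω → Fin D → ℝ) (i : Fin N) (hx₁ : ∀ᵐ ω ∂P, x₁ i ω ≠ GWO.center p)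
    (A C : ℕ → ℕ → Fin N → Fin 3 → Fin D → Ω → ℝ)
    (X : ℕ → ℕ → Fin N → Ω → Fin D → ℝ)
    (hX : ∀ T, GWO.IsStagnantRun P T p x₁ (A T) (C T) (X T)) :
    Tendsto (fun q : ℕ × ℕ => P.real (GWO.foundBy (fun s => X q.1 s i) (Set.Icc lb ub) q.2))
      GWO.iterToInfty (𝓝 1) :=
  proposition2_general P p lb ub hbox hdeg x₁ i A C X hX
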